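/- All graphs are finite, simple and undirected. A bipartite graph is chordal bipartite if it has no induced cycle of length at least $6$. Let $Y$ be the 7-vertex graph that is the disjoint union of a 4-cycle $C_4$ and a path $P_3$ on 3 vertices; a graph is $Y$-free if it has no induced subgraph isomorphic to $Y$. A class of graphs is factorial if it is hereditary (closed under taking induced subgraphs) and the number of labelled $n$-vertex graphs in it is $2^{\Theta(n\log n)}$. For distinct vertices $x,y$ of a graph $G$, let $\mathrm{sd}(x,y)$ be the number of vertices in $V(G)\setminus\{x,y\}$ adjacent to exactly one of $x$ and $y$. **Theorem.** The class of $Y$-free chordal bipartite graphs is factorial. Moreover: 1. There is a constant $c$ such that every $Y$-free chordal bipartite graph with at least one vertex has a vertex of degree at most $c$ or two distinct vertices $x,y$ with $\mathrm{sd}(x,y)\le c$. 2. There is a constant $K$ such that for every $n$ the labelled $n$-vertex $Y$-free chordal bipartite graphs can be encoded injectively by binary words of length at most $K\,n\log_2 n$ (with $n\log_2 n$ read as $0$ for $n=0$). -/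

import Mathlib

open SimpleGraph

/-- A class of graphs, as a predicate; it is only ever evaluated on finite graphs. -/
abbrev GraphClass : Type 1 := ∀ V : Type, SimpleGraph V → Prop

namespace GraphClass

/-- A class is hereditary if it is closed under taking induced subgraphs
(and, in particular, under isomorphism). -/
def IsHereditary (C : GraphClass) : Prop :=
  ∀ (V W : Type) [Finite V] [Finite W] (G : SimpleGraph V) (H : SimpleGraph W),
    H.IsIndContained G → C V G → C W H

/-- The speed of a class: the number of labelled `n`-vertex graphs in it. -/
noncomputable def speed (C : GraphClass) (n : ℕ) : ℕ :=
  Nat.card {G : SimpleGraph (Fin n) // C (Fin n) G}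

/-- A class is factorial if it is hereditary and contains `2 ^ Θ(n log n)` labelled
`n`-vertex graphs. -/
def IsFactorial (C : GraphClass) : Prop :=
  C.IsHereditary ∧
    ∃ a b : ℝ, 0 < a ∧ 0 < b ∧ ∀ᶠ n : ℕ in Filter.atTop,
      (2 : ℝ) ^ (a * (n * Real.logb 2 n)) ≤ (C.speed n : ℝ) ∧
        (C.speed n : ℝ) ≤ (2 : ℝ) ^ (b * (n * Real.logb 2 n))

end GraphClass

/-- `G` is `H`-free: no induced subgraph of `G` is isomorphic to `H`. -/
def IsInducedFree {U V : Type} (H : SimpleGraph U) (G : SimpleGraph V) : Prop :=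
  ¬ H.IsIndContained G

/-- A bipartite graph without chordless cycles of length at least `6`. -/
def IsChordalBipartite {V : Type} (G : SimpleGraph V) : Prop :=
  G.IsBipartite ∧ ∀ k : ℕ, 6 ≤ k → IsInducedFree (cycleGraph k) G

/-- The graph `Y`: the disjoint union of a 4-cycle and a path on 3 vertices. -/
def graphY : SimpleGraph (Fin 4 ⊕ Fin 3) :=
  cycleGraph 4 ⊕g pathGraph 3

/-- The class of `Y`-free chordal bipartite graphs. -/
def yFreeChordalBipartite : GraphClass := fun _ G =>
  IsChordalBipartite G ∧ IsInducedFree graphY G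

/-- The symmetric difference of `x` and `y` in `G`: the number of vertices other than `x` and `y`
that are adjacent to exactly one of them. -/
noncomputable def symDiffNumber {V : Type} (G : SimpleGraph V) (x y : V) : ℕ :=
  Set.ncard {z : V | z ≠ x ∧ z ≠ y ∧ Xor (G.Adj x z) (G.Adj y z)}

/-! Fix a bipartition (A, B). The core is `exists_low_degree_or_close_pair`: if all vertices of B
have degree above 24, then two vertices on one side have neighbourhoods differing in at most 24
places. Suppose not; let v in B have minimum degree and let U be its neighbourhood. Every other
vertex of B has many neighbours outside U, since otherwise it would be close to v. Some two vertices
of U have three common non-neighbours d₀, d₁, d₂. With v they form an induced P₃, so `Y`-freeness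
leaves any two dᵢ at most one common neighbour outside U. Deleting at most three vertices turns the
dᵢ into centres of three disjoint stars with leaves outside U.

These stars split B (`exists_close_pair_of_three_stars`): a vertex is poor if it sees at most one
leaf of every star not its own, and the rest are rich, seeing at least three leaves of each star.
`Y`-freeness excludes 4-cycles through two poor vertices, so the poor part spans a forest and has
few edges. It also makes each rich vertex see all but one of the leaf-side neighbours of any poor
vertex. A Helly property of C₆-free relations, `CrownFree.exists_pair`, replaces all rich vertices
by two of them, so enough leaf-side vertices see every rich vertex. By averaging, two of these have
few poor neighbours and are therefore close, a contradiction.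

For the count, a vertex of low degree or with a near twin is described by 26 symbols from an
alphabet of size at most n + 1, and deleting it stays in the class; star forests give the lower
bound. -/

/-! ### Bipartite relations: the structural core. -/

section Relation

variable {A B : Type*}

/-- The bipartite graph of `r` has no induced cycle on six vertices. -/
def CrownFree (r : A → B → Prop) : Prop :=
  ∀ a₁ a₂ a₃ b₁ b₂ b₃, ¬ r a₁ b₁ → r a₁ b₂ → r a₁ b₃ → r a₂ b₁ → ¬ r a₂ b₂ → r a₂ b₃ →
    r a₃ b₁ → r a₃ b₂ → ¬ r a₃ b₃ → False

/-- The bipartite graph of `r` has no induced disjoint union of a 4-cycle and a 3-vertex path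
with its centre in `B`. -/
def SquareCherryFree (r : A → B → Prop) : Prop :=
  ∀ a₁ a₂ b₁ b₂ a₃ a₄ b₃, a₁ ≠ a₂ → b₁ ≠ b₂ → a₃ ≠ a₄ →
    r a₁ b₁ → r a₁ b₂ → r a₂ b₁ → r a₂ b₂ → r a₃ b₃ → r a₄ b₃ →
    ¬ r a₁ b₃ → ¬ r a₂ b₃ → ¬ r a₃ b₁ → ¬ r a₃ b₂ → ¬ r a₄ b₁ → ¬ r a₄ b₂ → False

/-- The bipartite graph of `r` has no 4-cycle between `X` and `Z`. -/
def SquareFreeOn (r : A → B → Prop) (X : Finset A) (Z : Finset B) : Prop :=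
  ∀ a₁ ∈ X, ∀ a₂ ∈ X, ∀ b₁ ∈ Z, ∀ b₂ ∈ Z, a₁ ≠ a₂ → b₁ ≠ b₂ →
    r a₁ b₁ → r a₁ b₂ → r a₂ b₁ → r a₂ b₂ → False

open Classical in
/-- Whenever there is no 4-cycle between `X` and `Z`, there are at most `|X| + |Z|` edges between
them. -/
def SquareFreeSparse (r : A → B → Prop) : Prop :=
  ∀ (X : Finset A) (Z : Finset B), SquareFreeOn r X Z →
    ∑ b ∈ Z, (X.filter fun a => r a b).card ≤ X.card + Z.card

open Classical in
/-- Among the neighbourhoods of a nonempty finite set of vertices on one side, some two have their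
intersection contained in all the others. -/
theorem CrownFree.exists_pair {r : A → B → Prop} (h : CrownFree r) (S : Finset A)
    (hS : S.Nonempty) :
    ∃ a ∈ S, ∃ a' ∈ S, ∀ s ∈ S, ∀ b, r a b → r a' b → r s b := by
  induction hS using Finset.Nonempty.cons_induction with
  | singleton a => exact ⟨a, by simp, a, by simp, by simp⟩
  | cons l S hl hS ih =>
    obtain ⟨a, ha, a', ha', H⟩ := ih
    by_cases h1 : ∀ b, r a b → r a' b → r l b
    · refine ⟨a, by simp [ha], a', by simp [ha'], fun s hs b hb hb' => ?_⟩
      rcases Finset.mem_cons.1 hs with rfl | hs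
      · exact h1 b hb hb'
      · exact H s hs b hb hb'
    by_cases h2 : ∀ b, r a b → r l b → r a' b
    · refine ⟨a, by simp [ha], l, by simp, fun s hs b hb hb' => ?_⟩
      rcases Finset.mem_cons.1 hs with rfl | hs
      · exact hb'
      · exact H s hs b hb (h2 b hb hb')
    by_cases h3 : ∀ b, r a' b → r l b → r a b
    · refine ⟨a', by simp [ha'], l, by simp, fun s hs b hb hb' => ?_⟩
      rcases Finset.mem_cons.1 hs with rfl | hs
      · exact hb'
      · exact H s hs b (h3 b hb hb') hb
    -- None of the three pairs among `a`, `a'`, `l` works, and the three witnesses complete a crown.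
    push Not at h1 h2 h3
    obtain ⟨b₁, h11, h12, h13⟩ := h1
    obtain ⟨b₂, h21, h22, h23⟩ := h2
    obtain ⟨b₃, h31, h32, h33⟩ := h3
    exact (h l a' a b₁ b₂ b₃ h13 h22 h32 h12 h23 h31 h11 h21 h33).elim

open Classical in
/-- If there are at most `2|X|` edges between `X` and `Z`, then two vertices of `X` have at most
four neighbours in `Z`. -/
theorem exists_pair_card_le_four (r : A → B → Prop) (X : Finset A) (Z : Finset B)
    (hX : 2 ≤ X.card) (h : ∑ b ∈ Z, (X.filter fun a => r a b).card ≤ 2 * X.card) :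
    ∃ a ∈ X, ∃ a' ∈ X, a ≠ a' ∧ (Z.filter fun b => r a b).card ≤ 4 ∧
      (Z.filter fun b => r a' b).card ≤ 4 := by
  have hsum : ∑ a ∈ X, (Z.filter fun b => r a b).card =
      ∑ b ∈ Z, (X.filter fun a => r a b).card :=
    Finset.sum_card_bipartiteAbove_eq_sum_card_bipartiteBelow r
  set T := X.filter fun a => 5 ≤ (Z.filter fun b => r a b).card with hT
  -- Hence `5|T| ≤ 2|X|`; as `|X| ≥ 2`, at least two vertices of `X` lie outside `T`.
  have h5 : T.card * 5 ≤ ∑ a ∈ X, (Z.filter fun b => r a b).card :=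
    calc T.card * 5 = ∑ a ∈ T, 5 := by simp
      _ ≤ ∑ a ∈ T, (Z.filter fun b => r a b).card :=
        Finset.sum_le_sum fun a ha => (Finset.mem_filter.1 ha).2
      _ ≤ _ := Finset.sum_le_sum_of_subset (Finset.filter_subset _ _)
  have hc : T.card + (X.filter fun a => ¬ 5 ≤ (Z.filter fun b => r a b).card).card = X.card :=
    Finset.card_filter_add_card_filter_not _
  obtain ⟨a, ha, a', ha', hne⟩ := Finset.one_lt_card.1
    (show 1 < (X.filter fun a => ¬ 5 ≤ (Z.filter fun b => r a b).card).card by omega)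
  simp only [Finset.mem_filter] at ha ha'
  exact ⟨a, ha.1, a', ha'.1, hne, by omega, by omega⟩

open Classical in
/-- Three pairwise far apart stars inside `Ls` force two vertices of `Ls` with almost the same
neighbourhood, provided that all vertices of `B` but one have at least eight neighbours in
`Ls`. -/
theorem exists_close_pair_of_three_stars [Fintype A] [Fintype B] {r : A → B → Prop}
    (hC : CrownFree r) (hY : SquareCherryFree r) (hF : SquareFreeSparse r)
    (Ls : Finset A) (d : Fin 3 → B) (hd : ∀ l ∈ Ls, ∀ i j, r l (d i) → r l (d j) → i = j)
    (hE : ∀ i, 4 ≤ (Ls.filter fun l => r l (d i)).card) (v : B)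
    (hv : ∀ b, b ≠ v → 8 ≤ (Ls.filter fun l => r l b).card) :
    ∃ a a' : A, a ≠ a' ∧ ∃ S : Finset B, S.card ≤ 8 ∧ ∀ b, b ∉ S → (r a b ↔ r a' b) := by
  set E : Fin 3 → Finset A := fun i => Ls.filter fun l => r l (d i) with hEdef
  -- This is why three stars are needed: two vertices meet at most two of them.
  have avoid : ∀ l₁ ∈ Ls, ∀ l₂ ∈ Ls, ∃ i, ¬ r l₁ (d i) ∧ ¬ r l₂ (d i) := by
    intro l₁ h₁ l₂ h₂
    by_contra! H
    have a := H 0; have b := H 1; have c := H 2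
    have := hd l₁ h₁; have := hd l₂ h₂
    by_cases p0 : r l₁ (d 0) <;> by_cases p1 : r l₁ (d 1) <;> by_cases p2 : r l₁ (d 2) <;> grind
  set P : Finset B := Finset.univ.filter fun p =>
    ∀ i, p ≠ d i → ((E i).filter fun l => r l p).card ≤ 1 with hP
  -- a rich vertex misses at most one vertex of each other star
  have rich : ∀ w i j, i ≠ j → w ≠ d i → 2 ≤ ((E i).filter fun l => r l w).card →
      w ≠ d j ∧ 3 ≤ ((E j).filter fun l => r l w).card := by
    intro w i j hij hwi h2
    obtain ⟨e, he, e', he', hee⟩ := Finset.one_lt_card.1 h2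
    simp only [hEdef, Finset.mem_filter] at he he'
    refine ⟨fun hw => hij (hd e he.1.1 i j he.1.2 (hw ▸ he.2)), ?_⟩
    have hc : ((E j).filter fun l => r l w).card + ((E j).filter fun l => ¬ r l w).card =
      (E j).card := Finset.card_filter_add_card_filter_not _
    have h4 : 4 ≤ (E j).card := hE j
    by_contra hlt
    obtain ⟨l, hl, l', hl', hll⟩ := Finset.one_lt_card.1
      (show 1 < ((E j).filter fun l => ¬ r l w).card by omega)
    simp only [hEdef, Finset.mem_filter] at hl hl'
    exact hY e e' (d i) w l l' (d j) hee (Ne.symm hwi) hll he.1.2 he.2 he'.1.2 he'.2 hl.1.2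
      hl'.1.2 (fun h => hij (hd e he.1.1 i j he.1.2 h)) (fun h => hij (hd e' he'.1.1 i j he'.1.2 h))
      (fun h => hij (hd l hl.1.1 i j h hl.1.2)) hl.2
      (fun h => hij (hd l' hl'.1.1 i j h hl'.1.2)) hl'.2
  -- For the star that witnesses richness itself, pass to another star and come back.
  have rich' : ∀ w, w ∉ P → ∀ j, w ≠ d j ∧ 3 ≤ ((E j).filter fun l => r l w).card := by
    intro w hw j
    simp only [hP, Finset.mem_filter, Finset.mem_univ, true_and, not_forall, not_le] at hw
    obtain ⟨i, hwi, h2⟩ := hw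
    obtain ⟨k, hki⟩ : ∃ k : Fin 3, i ≠ k := ⟨i + 1, by fin_cases i <;> decide⟩
    by_cases hij : i = j
    · subst hij
      obtain ⟨h3, h4⟩ := rich w i k hki hwi h2
      exact rich w k i hki.symm h3 (by omega)
    · exact rich w i j hij hwi h2
  have poor : ∀ p ∈ P, ∀ i, p ≠ d i → ((E i).filter fun l => r l p).card ≤ 1 :=
    fun p hp => (Finset.mem_filter.1 hp).2
  -- A star avoided by both `l₁` and `l₂` has four leaves, of which `p₁` and `p₂` each see at most
  -- one; the remaining two form a cherry that is anticomplete to the square.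
  have sqfree : SquareFreeOn r Ls P := by
    intro l₁ h₁ l₂ h₂ p₁ hp₁ p₂ hp₂ hl hp h11 h12 h21 h22
    obtain ⟨i, hi1, hi2⟩ := avoid l₁ h₁ l₂ h₂
    have n1 := poor p₁ hp₁ i (fun h => hi1 (h ▸ h11))
    have n2 := poor p₂ hp₂ i (fun h => hi1 (h ▸ h12))
    have h4 : 4 ≤ (E i).card := hE i
    have hsub : E i ⊆ ((E i).filter fun l => r l p₁) ∪ ((E i).filter fun l => r l p₂) ∪
        ((E i).filter fun l => ¬ r l p₁ ∧ ¬ r l p₂) := by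
      intro x hx
      simp only [Finset.mem_union, Finset.mem_filter]
      tauto
    have hcard := (Finset.card_le_card hsub).trans ((Finset.card_union_le _ _).trans
      (Nat.add_le_add_right (Finset.card_union_le _ _) _))
    obtain ⟨e, he, e', he', hee⟩ := Finset.one_lt_card.1
      (show 1 < ((E i).filter fun l => ¬ r l p₁ ∧ ¬ r l p₂).card by omega)
    simp only [hEdef, Finset.mem_filter] at he he'
    exact hY l₁ l₂ p₁ p₂ e e' (d i) hl hp hee h11 h12 h21 h22 he.1.2 he'.1.2 hi1 hi2
      he.2.1 he.2.2 he'.2.1 he'.2.2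
  -- Here the square uses `d i`, `w` and two leaves missed by `p`; the cherry is centred at `p`.
  have miss : ∀ p ∈ P, ∀ w, w ∉ P → ((Ls.filter fun l => r l p).filter fun l => ¬ r l w).card ≤ 1 := by
    intro p hp w hw
    by_contra hlt
    obtain ⟨l, hl, l', hl', hll⟩ := Finset.one_lt_card.1 (not_le.1 hlt)
    simp only [Finset.mem_filter] at hl hl'
    obtain ⟨i, hi1, hi2⟩ := avoid l hl.1.1 l' hl'.1.1
    have n1 := poor p hp i (fun h => hi1 (h ▸ hl.1.2))
    obtain ⟨hwd, n2⟩ := rich' w hw i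
    have hsub : ((E i).filter fun l => r l w) ⊆ ((E i).filter fun l => r l p) ∪
        ((E i).filter fun l => r l w ∧ ¬ r l p) := by
      intro x hx
      simp only [Finset.mem_union, Finset.mem_filter] at hx ⊢
      tauto
    have hcard := (Finset.card_le_card hsub).trans (Finset.card_union_le _ _)
    obtain ⟨e, he, e', he', hee⟩ := Finset.one_lt_card.1
      (show 1 < ((E i).filter fun l => r l w ∧ ¬ r l p).card by omega)
    simp only [hEdef, Finset.mem_filter] at he he'
    exact hY e e' (d i) w l l' p hee (Ne.symm hwd) hll he.1.2 he.2.1 he'.1.2 he'.2.1 hl.1.2 hl'.1.2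
      he.2.2 he'.2.2 hi1 hl.2 hi2 hl'.2
  set Lc : Finset A := Ls.filter fun l => ∀ w, w ∉ P → r l w with hLc
  -- The Helly property on the B side gives two rich vertices whose common neighbours see all rich
  -- vertices; each costs at most one neighbour of `p`.
  have drop : ∀ p ∈ P, (Ls.filter fun l => r l p).card ≤ (Lc.filter fun l => r l p).card + 2 := by
    intro p hp
    have hflip : CrownFree fun b a => r a b := fun b₁ b₂ b₃ a₁ a₂ a₃ h1 h2 h3 h4 h5 h6 h7 h8 h9 =>
      hC a₁ a₂ a₃ b₁ b₂ b₃ h1 h4 h7 h2 h5 h8 h3 h6 h9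
    by_cases hne : (Finset.univ.filter fun w => w ∉ P).Nonempty
    · obtain ⟨w, hw, w', hw', H⟩ := hflip.exists_pair _ hne
      simp only [Finset.mem_filter, Finset.mem_univ, true_and] at hw hw' H
      have hsub : (Ls.filter fun l => r l p) ⊆ (Lc.filter fun l => r l p) ∪
          (((Ls.filter fun l => r l p).filter fun l => ¬ r l w) ∪
            ((Ls.filter fun l => r l p).filter fun l => ¬ r l w')) := by
        intro x hx
        simp only [hLc, Finset.mem_union, Finset.mem_filter] at hx ⊢
        by_cases h1 : r x w
        · by_cases h2 : r x w'
          · exact Or.inl ⟨⟨hx.1, fun s hs => H s hs x h1 h2⟩, hx.2⟩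
          · exact Or.inr (Or.inr ⟨hx, h2⟩)
        · exact Or.inr (Or.inl ⟨hx, h1⟩)
      have := (Finset.card_le_card hsub).trans ((Finset.card_union_le _ _).trans
        (Nat.add_le_add_left (Finset.card_union_le _ _) _))
      have := miss p hp w hw
      have := miss p hp w' hw'
      omega
    · have : (Ls.filter fun l => r l p) ⊆ (Lc.filter fun l => r l p) := by
        intro x hx
        simp only [hLc, Finset.mem_filter] at hx ⊢
        exact ⟨⟨hx.1, fun w hw => (hne ⟨w, by simpa using hw⟩).elim⟩, hx.2⟩
      have := Finset.card_le_card this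
      omega
  have dinj : Function.Injective d := by
    intro i j hij
    obtain ⟨l, hl⟩ := Finset.card_pos.1 (show 0 < (E i).card from lt_of_lt_of_le (by norm_num) (hE i))
    simp only [hEdef, Finset.mem_filter] at hl
    exact hd l hl.1 i j hl.2 (hij ▸ hl.2)
  have dP : ∀ j, d j ∈ P := fun j => by
    by_contra h
    exact (rich' _ h j).1 rfl
  have hP3 : 3 ≤ P.card := by
    have : (Finset.univ.image d) ⊆ P := by
      intro x hx
      obtain ⟨j, -, rfl⟩ := Finset.mem_image.1 hx
      exact dP j
    have h := Finset.card_le_card this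
    rwa [Finset.card_image_of_injective _ dinj, Finset.card_univ, Fintype.card_fin] at h
  have hlow : 6 * (P.card - 1) ≤ ∑ b ∈ P, (Lc.filter fun a => r a b).card :=
    calc 6 * (P.card - 1) ≤ 6 * (P.erase v).card :=
          Nat.mul_le_mul_left _ Finset.pred_card_le_card_erase
      _ = ∑ b ∈ P.erase v, 6 := by simp [mul_comm]
      _ ≤ ∑ b ∈ P.erase v, (Lc.filter fun a => r a b).card := by
          refine Finset.sum_le_sum fun b hb => ?_
          have h1 := drop b (Finset.mem_of_mem_erase hb)
          have h2 := hv b (Finset.ne_of_mem_erase hb)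
          omega
      _ ≤ _ := Finset.sum_le_sum_of_subset (Finset.erase_subset _ _)
  have hup := hF Lc P fun a₁ h₁ a₂ h₂ => sqfree a₁ (Finset.filter_subset _ _ h₁) a₂
    (Finset.filter_subset _ _ h₂)
  -- From `6(|P| - 1) ≤ |Lc| + |P|` and `|P| ≥ 3` follow `|P| ≤ |Lc|` and `|Lc| ≥ 2`, so there are
  -- at most `2|Lc|` edges.
  obtain ⟨a, ha, a', ha', hne, h4, h4'⟩ :=
    exists_pair_card_le_four r Lc P (by omega) (by omega)
  refine ⟨a, a', hne, (P.filter fun b => r a b) ∪ (P.filter fun b => r a' b),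
    (Finset.card_union_le _ _).trans (by omega), fun b hb => ?_⟩
  simp only [Finset.mem_union, Finset.mem_filter] at hb
  by_cases hbP : b ∈ P
  · tauto
  · exact iff_of_true ((Finset.mem_filter.1 ha).2 b hbP) ((Finset.mem_filter.1 ha').2 b hbP)

open Classical in
/-- Among sufficiently many pairwise far apart vertices of `A`, some two have three common
non-neighbours. -/
theorem CrownFree.exists_three_common_nonneighbours [Fintype B] {r : A → B → Prop}
    (hC : CrownFree r)
    (hA : ∀ a a' : A, a ≠ a' → ∀ S : Finset B, S.card ≤ 24 → ∃ b, b ∉ S ∧ ¬ (r a b ↔ r a' b))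
    (U : Finset A) (hUv : 24 < U.card) :
    ∃ u ∈ U, ∃ u' ∈ U, u ≠ u' ∧
      3 ≤ (Finset.univ.filter fun b => ¬ r u b ∧ ¬ r u' b).card := by
  set M : A → Finset B := fun u => Finset.univ.filter fun b => ¬ r u b with hM
  -- Two vertices with at most five non-neighbours each would differ in at most ten places.
  have hsmall : (U.filter fun u => ¬ 6 ≤ (M u).card).card ≤ 1 := by
    by_contra! hlt
    obtain ⟨u, hu, u', hu', hne⟩ := Finset.one_lt_card.1 hlt
    simp only [Finset.mem_filter] at hu hu'
    obtain ⟨b, hbS, hb⟩ := hA u u' hne (M u ∪ M u') ((Finset.card_union_le _ _).trans (by omega))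
    simp only [hM, Finset.mem_union, Finset.mem_filter, Finset.mem_univ, true_and] at hbS
    tauto
  set T := U.filter fun u => 6 ≤ (M u).card with hT
  have hTU : T.card + (U.filter fun u => ¬ 6 ≤ (M u).card).card = U.card :=
    Finset.card_filter_add_card_filter_not _
  have hMM : ∀ a a', M a ∩ M a' = Finset.univ.filter fun b => ¬ r a b ∧ ¬ r a' b := by
    intro a a'
    ext b
    simp [hM]
  simp only [← hMM]
  obtain ⟨a, ha, a', ha', H⟩ := hC.exists_pair T (Finset.card_pos.1 (by omega))
  obtain ⟨s, hs⟩ : (T \ {a, a'}).Nonempty := by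
    have h1 := Finset.le_card_sdiff {a, a'} T
    have h2 : ({a, a'} : Finset A).card ≤ 2 := Finset.card_le_two
    exact Finset.card_pos.1 (by omega)
  simp only [Finset.mem_sdiff, Finset.mem_insert, Finset.mem_singleton, not_or] at hs
  obtain ⟨hsT, hsa, hsa'⟩ := hs
  -- The Helly pair read in complements: a third vertex shares half of its at least six
  -- non-neighbours with `a` or `a'`.
  have hsub : M s ⊆ (M s ∩ M a) ∪ (M s ∩ M a') := by
    intro b hb
    have := H s hsT b
    simp only [hM, Finset.mem_union, Finset.mem_inter, Finset.mem_filter, Finset.mem_univ,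
      true_and] at hb ⊢
    tauto
  have hcard := (Finset.card_le_card hsub).trans (Finset.card_union_le _ _)
  have h6 := (Finset.mem_filter.1 hsT).2
  by_cases h : 3 ≤ (M s ∩ M a).card
  · exact ⟨s, (Finset.mem_filter.1 hsT).1, a, (Finset.mem_filter.1 ha).1, hsa, h⟩
  · exact ⟨s, (Finset.mem_filter.1 hsT).1, a', (Finset.mem_filter.1 ha').1, hsa', by omega⟩

open Classical in
/-- In a sparse relation without crowns and square-cherry pairs, some vertex of `B` has low degree or
two vertices on the same side have almost the same neighbourhood. -/
theorem exists_low_degree_or_close_pair [Fintype A] [Fintype B] [Nonempty B] {r : A → B → Prop}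
    (hC : CrownFree r) (hY : SquareCherryFree r) (hF : SquareFreeSparse r)
    (hdeg : ∀ b, 24 < (Finset.univ.filter fun a => r a b).card) :
    (∃ a a' : A, a ≠ a' ∧ ∃ S : Finset B, S.card ≤ 24 ∧ ∀ b, b ∉ S → (r a b ↔ r a' b)) ∨
    ∃ b b' : B, b ≠ b' ∧ ∃ S : Finset A, S.card ≤ 24 ∧ ∀ a, a ∉ S → (r a b ↔ r a b') := by
  by_contra! ⟨hA, hB⟩
  have hA' : ∀ a a' : A, a ≠ a' → ∀ S : Finset B, S.card ≤ 24 → ∃ b, b ∉ S ∧ ¬ (r a b ↔ r a' b) := by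
    intro a a' h S hS
    obtain ⟨b, hb, hb'⟩ := hA a a' h S hS
    exact ⟨b, hb, by tauto⟩
  obtain ⟨v, -, hvmin⟩ := Finset.exists_min_image Finset.univ
    (fun b => (Finset.univ.filter fun a => r a b).card) Finset.univ_nonempty
  set U := Finset.univ.filter fun a => r a v with hU
  have hUv : 24 < U.card := hdeg v
  -- every other vertex of `B` has many neighbours outside `U`
  have hout : ∀ b, b ≠ v → 12 < (Finset.univ.filter fun a => r a b ∧ a ∉ U).card := by
    intro b hb
    by_contra! hlt
    -- By minimality of `v`, no more vertices lie in `U` only than in the neighbourhood of `b` only,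
    -- so both differences have at most 12 elements.
    have hle : U.card ≤ (Finset.univ.filter fun a => r a b).card := hvmin b (Finset.mem_univ _)
    have e1 : (U.filter fun a => r a b).card + (U.filter fun a => ¬ r a b).card = U.card :=
      Finset.card_filter_add_card_filter_not _
    have e2 : (Finset.univ.filter fun a => r a b).card ≤
        (U.filter fun a => r a b).card + (Finset.univ.filter fun a => r a b ∧ a ∉ U).card := by
      refine (Finset.card_le_card fun x hx => ?_).trans (Finset.card_union_le _ _)
      simp only [Finset.mem_union, Finset.mem_filter, Finset.mem_univ, true_and] at hx ⊢
      tauto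
    obtain ⟨a, haS, ha⟩ := hB b v hb ((U.filter fun a => ¬ r a b) ∪
      (Finset.univ.filter fun a => r a b ∧ a ∉ U)) ((Finset.card_union_le _ _).trans (by omega))
    simp only [hU, Finset.mem_union, Finset.mem_filter, Finset.mem_univ, true_and] at haS
    tauto
  obtain ⟨u, hu, u', hu', hne, h3⟩ :=
    hC.exists_three_common_nonneighbours hA' U hUv
  obtain ⟨d, dinj, hdM⟩ : ∃ d : Fin 3 → B, Function.Injective d ∧
      ∀ i, ¬ r u (d i) ∧ ¬ r u' (d i) := by
    obtain ⟨D, hD, hD3⟩ := Finset.exists_subset_card_eq h3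
    refine ⟨fun i => (D.equivFinOfCardEq hD3).symm i, fun i j hij =>
      (D.equivFinOfCardEq hD3).symm.injective (Subtype.ext hij), fun i => ?_⟩
    simpa using hD ((D.equivFinOfCardEq hD3).symm i).2
  have hruv : r u v := (Finset.mem_filter.1 hu).2
  have hruv' : r u' v := (Finset.mem_filter.1 hu').2
  -- two of the three chosen vertices have at most one common neighbour outside `U`
  have hcommon : ∀ i j, i ≠ j →
      (Finset.univ.filter fun a => a ∉ U ∧ r a (d i) ∧ r a (d j)).card ≤ 1 := by
    intro i j hij
    by_contra! hlt
    obtain ⟨a, ha, a', ha', haa⟩ := Finset.one_lt_card.1 hlt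
    simp only [hU, Finset.mem_filter, Finset.mem_univ, true_and] at ha ha'
    exact hY a a' (d i) (d j) u u' v haa (fun h => hij (dinj h)) hne ha.2.1 ha.2.2 ha'.2.1 ha'.2.2
      hruv hruv' ha.1 ha'.1 (hdM i).1 (hdM j).1 (hdM i).2 (hdM j).2
  obtain ⟨F, hF3, hFd⟩ : ∃ F : Finset A, F.card ≤ 3 ∧
      ∀ a, a ∉ U → a ∉ F → ∀ i j, r a (d i) → r a (d j) → i = j := by
    refine ⟨(Finset.univ.filter fun a => a ∉ U ∧ r a (d 0) ∧ r a (d 1)) ∪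
      (Finset.univ.filter fun a => a ∉ U ∧ r a (d 0) ∧ r a (d 2)) ∪
      (Finset.univ.filter fun a => a ∉ U ∧ r a (d 1) ∧ r a (d 2)), ?_, ?_⟩
    · have h01 := hcommon 0 1 (by decide)
      have h02 := hcommon 0 2 (by decide)
      have h12 := hcommon 1 2 (by decide)
      exact (Finset.card_union_le _ _).trans
        ((Nat.add_le_add_right (Finset.card_union_le _ _) _).trans (by omega))
    · intro a haU haF
      have h01 : ¬ (r a (d 0) ∧ r a (d 1)) := fun h => haF (by simp [haU, h])
      have h02 : ¬ (r a (d 0) ∧ r a (d 2)) := fun h => haF (by simp [haU, h])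
      have h12 : ¬ (r a (d 1) ∧ r a (d 2)) := fun h => haF (by simp [haU, h])
      simp only [Fin.forall_fin_succ, Fin.forall_fin_zero]
      simp
      tauto
  set Ls : Finset A := Finset.univ.filter fun a => a ∉ U ∧ a ∉ F with hLs
  have hv8 : ∀ b, b ≠ v → 8 ≤ (Ls.filter fun l => r l b).card := by
    intro b hb
    have h12 := hout b hb
    have hsub : (Finset.univ.filter fun a => r a b ∧ a ∉ U) ⊆ (Ls.filter fun l => r l b) ∪ F := by
      intro x hx
      simp only [hLs, Finset.mem_union, Finset.mem_filter, Finset.mem_univ, true_and] at hx ⊢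
      tauto
    have := (Finset.card_le_card hsub).trans (Finset.card_union_le _ _)
    omega
  obtain ⟨a, a', haa, S, hS, H⟩ := exists_close_pair_of_three_stars hC hY hF Ls d
    (fun l hl => hFd l (Finset.mem_filter.1 hl).2.1 (Finset.mem_filter.1 hl).2.2)
    (fun i => le_trans (by norm_num) (hv8 (d i) fun h => (hdM i).1 (h ▸ hruv))) v hv8
  obtain ⟨b, hb, hb'⟩ := hA a a' haa S (by omega)
  have := H b hb
  tauto

end Relation

/-! ### Induced cycles and forests. -/

section Acyclic

theorem cycleGraph_adj_iff_val {n : ℕ} (hn : 2 ≤ n) {u v : Fin n} :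
    (cycleGraph n).Adj u v ↔ u.val + 1 = v.val ∨ v.val + 1 = u.val ∨
      (u.val = 0 ∧ v.val + 1 = n) ∨ (v.val = 0 ∧ u.val + 1 = n) := by
  have key : ∀ u v : Fin n, (u - v).val = 1 ↔ v.val + 1 = u.val ∨ (u.val = 0 ∧ v.val + 1 = n) := by
    intro u v
    have := u.isLt
    have := v.isLt
    rcases le_or_gt v u with h | h
    · rw [Fin.sub_val_of_le h]
      have : v.val ≤ u.val := h
      omega
    · rw [Fin.coe_sub_iff_lt.2 h]
      have : u.val < v.val := h
      omega
  rw [cycleGraph_adj', key, key]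
  tauto

variable {V : Type*} {G : SimpleGraph V}

/-- A shortest cycle is induced. -/
theorem isIndContained_cycleGraph_of_minimal {n : ℕ} (hn : 3 ≤ n) (h : cycleGraph n ⊑ G)
    (hmin : ∀ m, 3 ≤ m → m < n → ¬ cycleGraph m ⊑ G) : cycleGraph n ⊴ G := by
  obtain ⟨f⟩ := h
  have hadj : ∀ {i j : Fin n}, (cycleGraph n).Adj i j → G.Adj (f i) (f j) :=
    fun h => f.toHom.map_adj h
  have hinj : Function.Injective f := f.injective
  -- A chord from `i` to `j` closes the segment between them into a shorter cycle.
  have key : ∀ i j : Fin n, i.val < j.val → G.Adj (f i) (f j) → (cycleGraph n).Adj i j := by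
    intro i j hij hG
    by_contra hne
    rw [cycleGraph_adj_iff_val (by omega)] at hne
    push Not at hne
    have hj := j.isLt
    refine hmin (j.val - i.val + 1) (by omega) (by omega) ⟨⟨⟨fun t => f ⟨i.val + t.val, by omega⟩,
      ?_⟩, ?_⟩⟩
    · intro s t hst
      rw [cycleGraph_adj_iff_val (by omega)] at hst
      rcases hst with h | h | ⟨h, h'⟩ | ⟨h, h'⟩
      · exact hadj ((cycleGraph_adj_iff_val (by omega)).2 (Or.inl (by simp; omega)))
      · exact hadj ((cycleGraph_adj_iff_val (by omega)).2 (Or.inr (Or.inl (by simp; omega))))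
      · have e1 : (⟨i.val + s.val, by omega⟩ : Fin n) = i :=
          Fin.ext (show i.val + s.val = i.val by omega)
        have e2 : (⟨i.val + t.val, by omega⟩ : Fin n) = j :=
          Fin.ext (show i.val + t.val = j.val by omega)
        rw [e1, e2]
        exact hG
      · have e1 : (⟨i.val + t.val, by omega⟩ : Fin n) = i :=
          Fin.ext (show i.val + t.val = i.val by omega)
        have e2 : (⟨i.val + s.val, by omega⟩ : Fin n) = j :=
          Fin.ext (show i.val + s.val = j.val by omega)
        rw [e1, e2]
        exact hG.symm
    · intro s t hst
      have := hinj hst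
      simp only [Fin.mk.injEq] at this
      exact Fin.ext (by omega)
  refine ⟨⟨⟨f, hinj⟩, fun {i j} => ⟨fun h => ?_, fun h => hadj h⟩⟩⟩
  rcases lt_trichotomy i.val j.val with hij | hij | hij
  · exact key i j hij h
  · have : i = j := Fin.ext hij
    subst this
    exact (G.irrefl h).elim
  · exact (key j i hij h.symm).symm

theorem isAcyclic_of_no_induced_cycle
    (h : ∀ n, 3 ≤ n → ¬ cycleGraph n ⊴ G) : G.IsAcyclic := by
  rw [isAcyclic_iff_free_cycleGraph]
  intro n
  induction n using Nat.strong_induction_on with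
  | _ n ih =>
    intro hn hc
    exact h n hn (isIndContained_cycleGraph_of_minimal hn hc fun m h3 hm => ih m hm h3)

-- A forest extends to a spanning tree of the complete graph on its vertices.
open Classical in
theorem SimpleGraph.IsAcyclic.card_edgeFinset_le [Fintype V] (h : G.IsAcyclic) :
    G.edgeFinset.card ≤ Fintype.card V := by
  cases isEmpty_or_nonempty V
  · have : G = ⊥ := Subsingleton.elim _ _
    subst this
    simp
  obtain ⟨F, hGF, hF⟩ := exists_maximal_isAcyclic_of_le_isAcyclic (le_top (a := G)) h
  simp only [le_top, true_and] at hF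
  have hT := (maximal_isAcyclic_iff_isTree.1 hF).card_edgeFinset
  have := Finset.card_le_card (edgeFinset_mono hGF)
  omega

end Acyclic

/-! ### From graphs to relations. -/

section Bipartition

variable {V : Type} {G : SimpleGraph V} {p : V → Prop}

/-- The adjacency relation of `G` between the two parts of a bipartition. -/
def partAdj (G : SimpleGraph V) (p : V → Prop) (a : {v // ¬ p v}) (b : {v // p v}) : Prop :=
  G.Adj a b

theorem crownFree_partAdj (hp : ∀ x y, G.Adj x y → (p x ↔ ¬ p y))
    (h : ¬ cycleGraph 6 ⊴ G) : CrownFree (partAdj G p) := by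
  intro a₁ a₂ a₃ b₁ b₂ b₃ h11 h12 h13 h21 h22 h23 h31 h32 h33
  simp only [partAdj] at *
  have nA : ∀ a a' : {v // ¬ p v}, ¬ G.Adj a a' := fun a a' h => by
    have := hp _ _ h
    exact a.2 (this.2 a'.2)
  have nB : ∀ b b' : {v // p v}, ¬ G.Adj b b' := fun b b' h => (hp _ _ h).1 b.2 b'.2
  set f : Fin 6 → V := ![a₁, b₂, a₃, b₁, a₂, b₃] with hf
  have hrel : ∀ i j, G.Adj (f i) (f j) ↔ (cycleGraph 6).Adj i j := by
    intro i j
    rw [cycleGraph_adj_iff_val (by norm_num)]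
    fin_cases i <;> fin_cases j <;> simp [hf, nA, nB, h11, h12, h13, h21, h22, h23, h31, h32, h33,
      G.adj_comm b₁.1, G.adj_comm b₂.1, G.adj_comm b₃.1]
  refine h ⟨⟨⟨f, fun i j hij => ?_⟩, fun {i j} => hrel i j⟩⟩
  -- Injectivity is free: distinct vertices of the hexagon have distinct neighbourhoods.
  have : ∀ k, (cycleGraph 6).Adj i k ↔ (cycleGraph 6).Adj j k := fun k => by
    rw [← hrel, ← hrel, hij]
  clear hij
  clear_value f
  clear * - this
  revert this i j
  decide

theorem squareCherryFree_partAdj (hp : ∀ x y, G.Adj x y → (p x ↔ ¬ p y))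
    (h : ¬ graphY ⊴ G) : SquareCherryFree (partAdj G p) := by
  intro a₁ a₂ b₁ b₂ a₃ a₄ b₃ ha hb ha' h11 h12 h21 h22 h33 h43 h13 h23 h31 h32 h41 h42
  simp only [partAdj] at *
  have nA : ∀ a a' : {v // ¬ p v}, ¬ G.Adj a a' := fun a a' h => by
    have := hp _ _ h
    exact a.2 (this.2 a'.2)
  have nB : ∀ b b' : {v // p v}, ¬ G.Adj b b' := fun b b' h => (hp _ _ h).1 b.2 b'.2
  have nAB : ∀ (a : {v // ¬ p v}) (b : {v // p v}), a.1 ≠ b.1 := fun a b e => a.2 (e ▸ b.2)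
  have nBA : ∀ (a : {v // ¬ p v}) (b : {v // p v}), b.1 ≠ a.1 := fun a b e => a.2 (e ▸ b.2)
  have e1 : a₁.1 ≠ a₂.1 := fun e => ha (Subtype.ext e)
  have e2 : b₁.1 ≠ b₂.1 := fun e => hb (Subtype.ext e)
  have e3 : a₃.1 ≠ a₄.1 := fun e => ha' (Subtype.ext e)
  have e4 : a₁.1 ≠ a₃.1 := fun e => h31 (e ▸ h11)
  have e5 : a₁.1 ≠ a₄.1 := fun e => h41 (e ▸ h11)
  have e6 : a₂.1 ≠ a₃.1 := fun e => h31 (e ▸ h21)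
  have e7 : a₂.1 ≠ a₄.1 := fun e => h41 (e ▸ h21)
  have e8 : b₁.1 ≠ b₃.1 := fun e => h13 (e ▸ h11)
  have e9 : b₂.1 ≠ b₃.1 := fun e => h13 (e ▸ h12)
  set f : Fin 4 → V := ![a₁, b₁, a₂, b₂] with hf
  set g : Fin 3 → V := ![a₃, b₃, a₄] with hg
  have hfi : ∀ i j, f i = f j → i = j := by
    intro i j
    fin_cases i <;> fin_cases j <;> simp [hf, e1, e2, e1.symm, e2.symm, nAB, nBA]
  have hgi : ∀ i j, g i = g j → i = j := by
    intro i j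
    fin_cases i <;> fin_cases j <;> simp [hg, e3, e3.symm, nAB, nBA]
  have hfg : ∀ i j, f i ≠ g j := by
    intro i j
    fin_cases i <;> fin_cases j <;> simp [hf, hg, e4, e5, e6, e7, e8, e9, nAB, nBA]
  have hfr : ∀ i j, G.Adj (f i) (f j) ↔ (cycleGraph 4).Adj i j := by
    intro i j
    rw [cycleGraph_adj_iff_val (by norm_num)]
    fin_cases i <;> fin_cases j <;> simp [hf, nA, nB, h11, h12, h21, h22,
      G.adj_comm b₁.1, G.adj_comm b₂.1]
  have hgr : ∀ i j, G.Adj (g i) (g j) ↔ (pathGraph 3).Adj i j := by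
    intro i j
    rw [pathGraph_adj]
    fin_cases i <;> fin_cases j <;> simp [hg, nA, h33, h43, G.adj_comm b₃.1]
  have hfgr : ∀ i j, ¬ G.Adj (f i) (g j) := by
    intro i j
    fin_cases i <;> fin_cases j <;> simp [hf, hg, nA, nB, h13, h23, h31, h32, h41, h42,
      G.adj_comm b₁.1, G.adj_comm b₂.1]
  refine h ⟨⟨⟨Sum.elim f g, ?_⟩, ?_⟩⟩
  · rintro (i | i) (j | j) hij
    · exact congrArg _ (hfi i j hij)
    · exact (hfg i j hij).elim
    · exact (hfg j i hij.symm).elim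
    · exact congrArg _ (hgi i j hij)
  · rintro (i | i) (j | j)
    · exact (hfr i j).trans (by simp [graphY])
    · exact iff_of_false (hfgr i j) (by simp [graphY])
    · exact iff_of_false (fun h => hfgr j i h.symm) (by simp [graphY])
    · exact (hgr i j).trans (by simp [graphY])

theorem squareFreeSparse_partAdj (hp : ∀ x y, G.Adj x y → (p x ↔ ¬ p y))
    (h : ∀ k, 6 ≤ k → ¬ cycleGraph k ⊴ G) : SquareFreeSparse (partAdj G p) := by
  classical
  intro X Z hXZ
  set s : Finset V := X.map (Function.Embedding.subtype _) ∪ Z.map (Function.Embedding.subtype _)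
    with hs
  have hsX : ∀ v ∈ s, ¬ p v → ∃ a ∈ X, a.1 = v := by
    intro v hv hpv
    simp only [hs, Finset.mem_union, Finset.mem_map, Function.Embedding.subtype_apply] at hv
    rcases hv with ⟨a, ha, rfl⟩ | ⟨b, hb, rfl⟩
    · exact ⟨a, ha, rfl⟩
    · exact (hpv b.2).elim
  have hsZ : ∀ v ∈ s, p v → ∃ b ∈ Z, b.1 = v := by
    intro v hv hpv
    simp only [hs, Finset.mem_union, Finset.mem_map, Function.Embedding.subtype_apply] at hv
    rcases hv with ⟨a, ha, rfl⟩ | ⟨b, hb, rfl⟩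
    · exact (a.2 hpv).elim
    · exact ⟨b, hb, rfl⟩
  have hXs : ∀ a ∈ X, a.1 ∈ s := fun a ha => by
    simp only [hs, Finset.mem_union, Finset.mem_map, Function.Embedding.subtype_apply]
    exact Or.inl ⟨a, ha, rfl⟩
  have hZs : ∀ b ∈ Z, b.1 ∈ s := fun b hb => by
    simp only [hs, Finset.mem_union, Finset.mem_map, Function.Embedding.subtype_apply]
    exact Or.inr ⟨b, hb, rfl⟩
  have hno4 : ∀ x₀ x₁ x₂ x₃ : V, x₀ ∈ s → x₁ ∈ s → x₂ ∈ s → x₃ ∈ s → ¬ p x₀ → x₀ ≠ x₂ → x₁ ≠ x₃ →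
      G.Adj x₀ x₁ → G.Adj x₁ x₂ → G.Adj x₂ x₃ → G.Adj x₃ x₀ → False := by
    intro x₀ x₁ x₂ x₃ m0 m1 m2 m3 hp0 n02 n13 a01 a12 a23 a30
    have p1 : p x₁ := by have := hp _ _ a01; tauto
    have p2 : ¬ p x₂ := by have := hp _ _ a12; tauto
    have p3 : p x₃ := by have := hp _ _ a23; tauto
    obtain ⟨y₀, h0, rfl⟩ := hsX _ m0 hp0
    obtain ⟨y₁, h1, rfl⟩ := hsZ _ m1 p1
    obtain ⟨y₂, h2, rfl⟩ := hsX _ m2 p2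
    obtain ⟨y₃, h3, rfl⟩ := hsZ _ m3 p3
    exact hXZ y₀ h0 y₂ h2 y₁ h1 y₃ h3 (fun e => n02 (congrArg _ e)) (fun e => n13 (congrArg _ e))
      a01 a30.symm a12.symm a23
  -- Induced cycles of length at least 6 are excluded by `h`, odd ones by bipartiteness, and squares
  -- by `hXZ`.
  have hac : (G.induce (s : Set V)).IsAcyclic := by
    refine isAcyclic_of_no_induced_cycle fun n hn hc => ?_
    have hcG : cycleGraph n ⊴ G := hc.trans ⟨Embedding.induce _⟩
    by_cases h6 : 6 ≤ n
    · exact h n h6 hcG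
    obtain ⟨f⟩ := hc
    have hadj : ∀ i j, (cycleGraph n).Adj i j → G.Adj (f i).1 (f j).1 := fun i j hij => by
      simpa using f.map_adj_iff.2 hij
    obtain rfl | rfl | rfl : n = 3 ∨ n = 4 ∨ n = 5 := by omega
    · have a := hp _ _ (hadj 0 1 (by decide))
      have b := hp _ _ (hadj 1 2 (by decide))
      have c := hp _ _ (hadj 2 0 (by decide))
      tauto
    · have hinj : ∀ i j : Fin 4, i ≠ j → (f i).1 ≠ (f j).1 := fun i j hij e =>
        hij (f.injective (Subtype.ext e))
      have a01 := hadj 0 1 (by decide)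
      have a12 := hadj 1 2 (by decide)
      have a23 := hadj 2 3 (by decide)
      have a30 := hadj 3 0 (by decide)
      by_cases h0 : p (f 0).1
      · exact hno4 (f 1).1 (f 2).1 (f 3).1 (f 0).1 (f 1).2 (f 2).2 (f 3).2 (f 0).2
          ((hp _ _ a01).1 h0) (hinj _ _ (by decide)) (hinj _ _ (by decide)) a12 a23 a30 a01
      · exact hno4 (f 0).1 (f 1).1 (f 2).1 (f 3).1 (f 0).2 (f 1).2 (f 2).2 (f 3).2
          h0 (hinj _ _ (by decide)) (hinj _ _ (by decide)) a01 a12 a23 a30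
    · have a := hp _ _ (hadj 0 1 (by decide))
      have b := hp _ _ (hadj 1 2 (by decide))
      have c := hp _ _ (hadj 2 3 (by decide))
      have d := hp _ _ (hadj 3 4 (by decide))
      have e := hp _ _ (hadj 4 0 (by decide))
      tauto
  have hcard := hac.card_edgeFinset_le
  have hsc : Fintype.card (s : Set V) ≤ X.card + Z.card := by
    have : Fintype.card (s : Set V) = s.card := by simp
    rw [this]
    exact (Finset.card_union_le _ _).trans (by simp)
  refine le_trans ?_ (hcard.trans hsc)
  rw [← Finset.card_sigma]
  refine le_trans ?_ (Finset.card_image_le (f := Sym2.map Subtype.val))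
  refine Finset.card_le_card_of_injOn (fun q => s(q.2.1, q.1.1)) ?_ ?_
  · rintro ⟨b, a⟩ hq
    simp only [Finset.coe_sigma, Set.mem_sigma_iff, Finset.mem_coe, Finset.mem_filter] at hq
    refine Finset.mem_coe.2 (Finset.mem_image.2 ⟨s(⟨a.1, hXs a hq.2.1⟩, ⟨b.1, hZs b hq.1⟩), ?_, rfl⟩)
    rw [mem_edgeFinset, mem_edgeSet]
    exact hq.2.2
  · rintro ⟨b, a⟩ - ⟨b', a'⟩ - hq
    simp only [Sym2.eq_iff] at hq
    rcases hq with ⟨h1, h2⟩ | ⟨h1, h2⟩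
    · rw [Subtype.ext h1, Subtype.ext h2]
    · exact (a.2 (h1 ▸ b'.2)).elim

end Bipartition

/-! ### The structural dichotomy for graphs. -/

open Classical in
/-- Every nonempty finite `Y`-free chordal bipartite graph has a vertex of degree at most `24` or
two vertices whose neighbourhoods agree outside a set of at most `24` vertices. -/
theorem exists_degree_le_or_close {V : Type} [Finite V] [Nonempty V] (G : SimpleGraph V)
    (hG : yFreeChordalBipartite V G) :
    (∃ v : V, (G.neighborSet v).ncard ≤ 24) ∨
      ∃ x y : V, x ≠ y ∧ ∃ S : Finset V, S.card ≤ 24 ∧ ∀ z, z ∉ S → (G.Adj x z ↔ G.Adj y z) := by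
  by_contra! ⟨hdeg, hsd⟩
  obtain ⟨⟨⟨C⟩, hcyc⟩, hY⟩ := hG
  have := Fintype.ofFinite V
  obtain ⟨v₀⟩ := ‹Nonempty V›
  set p : V → Prop := fun v => C v = C v₀ with hpdef
  have hp : ∀ x y, G.Adj x y → (p x ↔ ¬ p y) := by
    intro x y hxy
    have := C.valid hxy
    simp only [hpdef]
    omega
  have : Nonempty {v // p v} := ⟨⟨v₀, rfl⟩⟩
  -- Closeness across the bipartition suffices, since neither vertex has neighbours in its own part.
  have lift : ∀ (q : V → Prop) (T : Finset {v // q v}) (x y : V), T.card ≤ 24 → x ≠ y →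
      (∀ z, G.Adj x z → q z) → (∀ z, G.Adj y z → q z) →
      (∀ z : {v // q v}, z ∉ T → (G.Adj x z ↔ G.Adj y z)) → False := by
    intro q T x y hT hxy hx hy H
    obtain ⟨z, hz, hz'⟩ := hsd x y hxy (T.map (Function.Embedding.subtype _)) (by simpa using hT)
    by_cases hq : q z
    · have := H ⟨z, hq⟩ (fun h => hz (Finset.mem_map.2 ⟨_, h, rfl⟩))
      simp only at this
      tauto
    · have := hx z
      have := hy z
      tauto
  rcases exists_low_degree_or_close_pair (crownFree_partAdj hp (hcyc 6 le_rfl))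
    (squareCherryFree_partAdj hp hY) (squareFreeSparse_partAdj hp hcyc) (fun b => by
      have h := hdeg b
      rw [Set.ncard_eq_toFinset_card'] at h
      refine h.trans_le ?_
      refine Finset.card_le_card_of_surjOn Subtype.val fun z hz => ?_
      have hz' : G.Adj b z := by simpa using hz
      exact ⟨⟨z, (hp _ _ hz').1 b.2⟩,
        Finset.mem_coe.2 (Finset.mem_filter.2 ⟨Finset.mem_univ _, hz'.symm⟩), rfl⟩) with
    ⟨a, a', haa, S, hS, H⟩ | ⟨b, b', hbb, S, hS, H⟩
  · refine lift _ S a a' hS (fun e => haa (Subtype.ext e)) (fun z hz => ?_) (fun z hz => ?_) H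
    · have := hp _ _ hz
      have := a.2
      tauto
    · have := hp _ _ hz
      have := a'.2
      tauto
  · refine lift _ S b b' hS (fun e => hbb (Subtype.ext e)) (fun z hz => (hp _ _ hz).1 b.2)
      (fun z hz => (hp _ _ hz).1 b'.2) fun z hz => ?_
    have := H z hz
    simp only [partAdj] at this
    rw [G.adj_comm b, G.adj_comm b']
    exact this

theorem symDiffNumber_le_of_close {V : Type} (G : SimpleGraph V) (x y : V) (S : Finset V)
    (H : ∀ z, z ∉ S → (G.Adj x z ↔ G.Adj y z)) : symDiffNumber G x y ≤ S.card := by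
  rw [symDiffNumber, ← Set.ncard_coe_finset]
  refine Set.ncard_le_ncard (fun z hz => ?_) S.finite_toSet
  by_contra hzS
  have := H z hzS
  obtain ⟨-, -, h⟩ := hz
  rw [Xor] at h
  tauto

/-! ### Upper bound and encoding. -/

section Counting

theorem yFreeChordalBipartite_isHereditary : yFreeChordalBipartite.IsHereditary := by
  intro V W _ _ G H ⟨f⟩ ⟨⟨hb, hc⟩, hY⟩
  exact ⟨⟨hb.of_hom f.toHom, fun k hk h => hc k hk (h.trans ⟨f⟩)⟩, fun h => hY (h.trans ⟨f⟩)⟩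

theorem exists_enumeration {α : Type*} (S : Finset α) {k : ℕ} (hS : S.card ≤ k) :
    ∃ e : Fin k → Option α, ∀ z, z ∈ S ↔ ∃ i, e i = some z := by
  refine ⟨fun i => if h : i.val < S.card then some (S.equivFin.symm ⟨i.val, h⟩).1 else none,
    fun z => ⟨fun hz => ⟨⟨(S.equivFin ⟨z, hz⟩).val, (S.equivFin ⟨z, hz⟩).2.trans_le hS⟩, ?_⟩, ?_⟩⟩
  · simp
  · rintro ⟨i, hi⟩
    simp only at hi
    split_ifs at hi with h
    rw [Option.some.injEq] at hi
    rw [← hi]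
    exact (S.equivFin.symm ⟨i.val, h⟩).2

/-- A vertex, an optional near twin, and a list of at most 24 corrections that together describe
the neighbourhood of the vertex. -/
theorem exists_neighbourhood_code {V : Type} [Finite V] [Nonempty V] (G : SimpleGraph V)
    (hG : yFreeChordalBipartite V G) :
    ∃ (v : V) (o : Option V) (e : Fin 24 → Option V), o ≠ some v ∧
      ∀ z, G.Adj v z ↔ ((∃ y, o = some y ∧ G.Adj y z) ↔ ¬ ∃ i, e i = some z) := by
  classical
  have := Fintype.ofFinite V
  rcases exists_degree_le_or_close G hG with ⟨v, hv⟩ | ⟨x, y, hxy, S, hS, H⟩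
  · rw [Set.ncard_eq_toFinset_card'] at hv
    obtain ⟨e, he⟩ := exists_enumeration _ hv
    refine ⟨v, none, e, by simp, fun z => ?_⟩
    rw [← he z]
    simp
  · obtain ⟨e, he⟩ := exists_enumeration (S.filter fun z => ¬ (G.Adj x z ↔ G.Adj y z))
      ((Finset.card_filter_le _ _).trans hS)
    refine ⟨x, some y, e, by simpa using hxy.symm, fun z => ?_⟩
    rw [← he z]
    have := H z
    simp only [Option.some.injEq, exists_eq_left', Finset.mem_filter]
    tauto

/-- The graph is recovered from one vertex, its optional near twin, the 24 correction slots and the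
graph left after deleting the vertex. -/
theorem speed_succ_le (n : ℕ) : yFreeChordalBipartite.speed (n + 1) ≤
    (n + 2) ^ 26 * yFreeChordalBipartite.speed n := by
  have hex : ∀ G : {G : SimpleGraph (Fin (n + 1)) // yFreeChordalBipartite (Fin (n + 1)) G}, _ :=
    fun G => exists_neighbourhood_code G.1 G.2
  choose v o e hne hspec using hex
  let code : {G : SimpleGraph (Fin (n + 1)) // yFreeChordalBipartite (Fin (n + 1)) G} →
      (Fin (n + 1) × Option (Fin (n + 1)) × (Fin 24 → Option (Fin (n + 1)))) ×
        {G : SimpleGraph (Fin n) // yFreeChordalBipartite (Fin n) G} := fun G =>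
    ((v G, o G, e G), ⟨G.1.comap (v G).succAboveEmb, yFreeChordalBipartite_isHereditary _ _ G.1 _
      ⟨Embedding.comap (v G).succAboveEmb G.1⟩ G.2⟩)
  have hinj : Function.Injective code := by
    intro G G' h
    simp only [code, Prod.mk.injEq, Subtype.mk.injEq] at h
    obtain ⟨⟨hv, ho, he⟩, hG⟩ := h
    have hrest : ∀ x y, x ≠ v G → y ≠ v G → (G.1.Adj x y ↔ G'.1.Adj x y) := by
      intro x y hx hy
      obtain ⟨i, rfl⟩ := Fin.exists_succAbove_eq hx
      obtain ⟨j, rfl⟩ := Fin.exists_succAbove_eq hy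
      have h1 : (G.1.comap (v G).succAboveEmb).Adj i j ↔
        (G'.1.comap (v G').succAboveEmb).Adj i j := by rw [hG]
      rw [← hv] at h1
      exact h1
    have hvz : ∀ z, z ≠ v G → (G.1.Adj (v G) z ↔ G'.1.Adj (v G) z) := by
      intro z hz
      have h2 := hspec G' z
      rw [← hv, ← ho, ← he] at h2
      rw [hspec G z, h2]
      -- The twin differs from the deleted vertex, so its adjacencies survive in the smaller graph.
      have : (∃ y, o G = some y ∧ G.1.Adj y z) ↔ ∃ y, o G = some y ∧ G'.1.Adj y z := by
        refine exists_congr fun y => and_congr_right fun hy => hrest y z ?_ hz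
        rintro rfl
        exact hne G hy
      rw [this]
    refine Subtype.ext (SimpleGraph.ext ?_)
    ext x y
    by_cases hx : x = v G
    · subst hx
      by_cases hy : y = v G
      · subst hy
        simp
      · exact hvz y hy
    · by_cases hy : y = v G
      · subst hy
        rw [G.1.adj_comm, G'.1.adj_comm]
        exact hvz x hx
      · exact hrest x y hx hy
  have hcard := Nat.card_le_card_of_injective code hinj
  simp only [Nat.card_prod, Nat.card_fun, Nat.card_eq_fintype_card (α := Fin _),
    Nat.card_eq_fintype_card (α := Option _), Fintype.card_option, Fintype.card_fin] at hcard
  refine hcard.trans (Nat.mul_le_mul_right _ ?_)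
  calc (n + 1) * ((n + 1 + 1) * (n + 1 + 1) ^ 24) ≤ (n + 2) * ((n + 1 + 1) * (n + 1 + 1) ^ 24) :=
        Nat.mul_le_mul_right _ (by omega)
    _ = (n + 2) ^ 26 := by ring

theorem speed_le_pow (n : ℕ) : yFreeChordalBipartite.speed n ≤ (n + 1) ^ (26 * n) := by
  induction n with
  | zero =>
    have : Subsingleton {G : SimpleGraph (Fin 0) // yFreeChordalBipartite (Fin 0) G} := inferInstance
    rw [GraphClass.speed]
    simpa using Finite.card_le_one_iff_subsingleton.2 this
  | succ n ih =>
    calc yFreeChordalBipartite.speed (n + 1)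
        ≤ (n + 2) ^ 26 * yFreeChordalBipartite.speed n := speed_succ_le n
      _ ≤ (n + 2) ^ 26 * (n + 2) ^ (26 * n) :=
        Nat.mul_le_mul_left _ (ih.trans (Nat.pow_le_pow_left (by omega) _))
      _ = (n + 1 + 1) ^ (26 * (n + 1)) := by ring

theorem speed_le_two_pow (n : ℕ) :
    yFreeChordalBipartite.speed n ≤ 2 ^ (26 * n * Nat.clog 2 (n + 1)) := by
  calc yFreeChordalBipartite.speed n ≤ (n + 1) ^ (26 * n) := speed_le_pow n
    _ ≤ (2 ^ Nat.clog 2 (n + 1)) ^ (26 * n) :=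
      Nat.pow_le_pow_left (Nat.le_pow_clog (by norm_num) _) _
    _ = 2 ^ (26 * n * Nat.clog 2 (n + 1)) := by rw [← pow_mul, mul_comm]

theorem clog_succ_le_two_mul_logb {n : ℕ} (hn : 2 ≤ n) :
    (Nat.clog 2 (n + 1) : ℝ) ≤ 2 * Real.logb 2 n := by
  have hpos : (0 : ℝ) < n := by positivity
  have h1 : (1 : ℝ) ≤ Real.logb 2 n := by
    rw [Real.le_logb_iff_rpow_le (by norm_num) hpos]
    simpa using (by exact_mod_cast hn : (2 : ℝ) ≤ n)
  have hb : 0 < Nat.clog 2 (n + 1) := Nat.clog_pos (by norm_num) (by omega)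
  have h2 : 2 ^ (Nat.clog 2 (n + 1) - 1) < n + 1 := Nat.pow_pred_clog_lt_self (by norm_num) (by omega)
  have h3 : ((Nat.clog 2 (n + 1) - 1 : ℕ) : ℝ) ≤ Real.logb 2 n := by
    rw [Real.le_logb_iff_rpow_le (by norm_num) hpos, Real.rpow_natCast]
    exact_mod_cast Nat.lt_succ_iff.1 h2
  rw [Nat.cast_sub hb, Nat.cast_one] at h3
  linarith

theorem code_length_le {n : ℕ} (hn : 2 ≤ n) :
    ((26 * n * Nat.clog 2 (n + 1) : ℕ) : ℝ) ≤ 52 * (n * Real.logb 2 n) := by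
  push_cast
  have := mul_le_mul_of_nonneg_left (clog_succ_le_two_mul_logb hn) (by positivity : (0 : ℝ) ≤ 26 * n)
  linarith

theorem exists_encoding (n : ℕ) :
    ∃ enc : {G : SimpleGraph (Fin n) // yFreeChordalBipartite (Fin n) G} → List Bool,
      Function.Injective enc ∧ ∀ G, ((enc G).length : ℝ) ≤ 52 * (n * Real.logb 2 n) := by
  rcases lt_or_ge n 2 with hn | hn
  -- For `n ≤ 1` the length bound is 0, and the empty word suffices for the only graph.
  · have : Subsingleton (Fin n) := Fin.subsingleton_iff_le_one.2 (by omega)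
    refine ⟨fun _ => [], fun G G' _ => Subsingleton.elim _ _, fun _ => ?_⟩
    interval_cases n <;> simp
  · have hle : Nat.card {G : SimpleGraph (Fin n) // yFreeChordalBipartite (Fin n) G} ≤
        Nat.card (Fin (26 * n * Nat.clog 2 (n + 1)) → Bool) := by
      simpa [GraphClass.speed] using speed_le_two_pow n
    have := Fintype.ofFinite {G : SimpleGraph (Fin n) // yFreeChordalBipartite (Fin n) G}
    rw [Nat.card_eq_fintype_card, Nat.card_eq_fintype_card] at hle
    obtain ⟨f⟩ := Function.Embedding.nonempty_of_card_le hle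
    refine ⟨fun G => List.ofFn (f G), fun G G' h => f.injective (List.ofFn_injective h), fun G => ?_⟩
    rw [List.length_ofFn]
    exact code_length_le hn

/-! ### Lower bound from star forests. -/

/-- The star forest on `Fin n` in which the leaf `i < m` is attached to the centre `m + g i`. -/
def starForest (n m : ℕ) (g : Fin m → Fin m) : SimpleGraph (Fin n) where
  Adj x y := (∃ i : Fin m, x.val = i ∧ y.val = m + g i) ∨ ∃ i : Fin m, y.val = i ∧ x.val = m + g i
  symm := ⟨fun _ _ h => h.symm⟩
  loopless := ⟨fun x h => by
    rcases h with ⟨i, h, h'⟩ | ⟨i, h, h'⟩ <;> have := i.2 <;> omega⟩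

variable {n m : ℕ} {g : Fin m → Fin m}

theorem starForest_lt_iff {x y : Fin n} (h : (starForest n m g).Adj x y) :
    x.val < m ↔ ¬ y.val < m := by
  rcases h with ⟨i, h, h'⟩ | ⟨i, h, h'⟩ <;> have := i.2 <;> omega

theorem starForest_leaf {x y : Fin n} (hx : x.val < m) (h : (starForest n m g).Adj x y) :
    y.val = m + g ⟨x.val, hx⟩ := by
  rcases h with ⟨i, h, h'⟩ | ⟨i, h, h'⟩
  · have : (⟨x.val, hx⟩ : Fin m) = i := Fin.ext h
    rw [this, h']
  · omega

/-- One of the two middle vertices is a leaf, and a leaf has only one neighbour. -/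
theorem starForest_no_path {x₀ x₁ x₂ x₃ : Fin n} (h01 : (starForest n m g).Adj x₀ x₁)
    (h12 : (starForest n m g).Adj x₁ x₂) (h23 : (starForest n m g).Adj x₂ x₃) (h02 : x₀ ≠ x₂)
    (h13 : x₁ ≠ x₃) : False := by
  by_cases h : x₁.val < m
  · exact h02 (Fin.ext ((starForest_leaf h h01.symm).trans (starForest_leaf h h12).symm))
  · have h2 : x₂.val < m := (starForest_lt_iff h12.symm).2 h
    exact h13 (Fin.ext ((starForest_leaf h2 h12.symm).trans (starForest_leaf h2 h23).symm))

theorem not_cycleGraph_isIndContained_starForest {k : ℕ} (hk : 4 ≤ k) :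
    ¬ cycleGraph k ⊴ starForest n m g := by
  rintro ⟨f⟩
  have hadj : ∀ i j : Fin k, i.val + 1 = j.val → (starForest n m g).Adj (f i) (f j) :=
    fun i j h => f.map_adj_iff.2 ((cycleGraph_adj_iff_val (by omega)).2 (Or.inl h))
  exact starForest_no_path (hadj ⟨0, by omega⟩ ⟨1, by omega⟩ rfl)
    (hadj ⟨1, by omega⟩ ⟨2, by omega⟩ rfl) (hadj ⟨2, by omega⟩ ⟨3, by omega⟩ rfl)
    (fun h => by simpa using f.injective h) (fun h => by simpa using f.injective h)

theorem starForest_mem (n m : ℕ) (g : Fin m → Fin m) :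
    yFreeChordalBipartite (Fin n) (starForest n m g) := by
  refine ⟨⟨⟨Coloring.mk (fun x => if x.val < m then 0 else 1) fun {x y} h => ?_⟩,
    fun k hk => not_cycleGraph_isIndContained_starForest (by omega)⟩, fun h => ?_⟩
  · have := starForest_lt_iff h
    split_ifs <;> simp_all
  · exact not_cycleGraph_isIndContained_starForest le_rfl
      (IsIndContained.trans ⟨Embedding.sumInl⟩ h)

/-- The map `g` can be read off its star forest, as each leaf has a unique neighbour. -/
theorem pow_self_le_speed {n m : ℕ} (h : 2 * m ≤ n) : m ^ m ≤ yFreeChordalBipartite.speed n := by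
  have hinj : Function.Injective fun g : Fin m → Fin m =>
      (⟨starForest n m g, starForest_mem n m g⟩ :
        {G : SimpleGraph (Fin n) // yFreeChordalBipartite (Fin n) G}) := by
    intro g g' hgg
    have hG : starForest n m g = starForest n m g' := congrArg Subtype.val hgg
    funext i
    have h1 : (starForest n m g).Adj ⟨i.val, by omega⟩ ⟨m + g i, by omega⟩ := Or.inl ⟨i, rfl, rfl⟩
    rw [hG] at h1
    have := starForest_leaf (n := n) (x := ⟨i.val, by omega⟩) i.2 h1
    exact Fin.ext (by simpa using this)
  simpa [GraphClass.speed] using Nat.card_le_card_of_injective _ hinj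

theorem two_rpow_le_speed {n : ℕ} (hn : 9 ≤ n) :
    (2 : ℝ) ^ ((1 / 6 : ℝ) * (n * Real.logb 2 n)) ≤ (yFreeChordalBipartite.speed n : ℝ) := by
  -- The factor `1 / 6` combines `n ≤ 3m` with `log n ≤ 2 log m`.
  obtain ⟨m, hm⟩ : ∃ m, m = n / 2 := ⟨_, rfl⟩
  have hm4 : 4 ≤ m := by omega
  have hnm : n ≤ 2 * m + 1 := by omega
  have hsq : n ≤ m ^ 2 := by nlinarith
  have hmpos : (0 : ℝ) < m := by positivity
  have hnpos : (0 : ℝ) < n := by positivity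
  have hlog : Real.logb 2 n ≤ 2 * Real.logb 2 m := by
    have h1 : Real.logb 2 n ≤ Real.logb 2 ((m : ℝ) ^ 2) :=
      Real.logb_le_logb_of_le (by norm_num) hnpos (by exact_mod_cast hsq)
    rwa [Real.logb_pow, Nat.cast_ofNat] at h1
  have hlog0 : 0 ≤ Real.logb 2 n :=
    Real.logb_nonneg (by norm_num) (by exact_mod_cast (by omega : 1 ≤ n))
  have h3 : (n : ℝ) ≤ 3 * m := by exact_mod_cast (by omega : n ≤ 3 * m)
  calc (2 : ℝ) ^ ((1 / 6 : ℝ) * (n * Real.logb 2 n)) ≤ 2 ^ (Real.logb 2 m * m) := by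
        refine Real.rpow_le_rpow_of_exponent_le (by norm_num) ?_
        have := mul_le_mul h3 hlog hlog0 (by positivity)
        linarith
    _ = ((m ^ m : ℕ) : ℝ) := by
        rw [Real.rpow_mul (by norm_num), Real.rpow_logb (by norm_num) (by norm_num) hmpos]
        simp
    _ ≤ _ := by exact_mod_cast pow_self_le_speed (by omega)

theorem speed_le_two_rpow {n : ℕ} (hn : 2 ≤ n) :
    (yFreeChordalBipartite.speed n : ℝ) ≤ (2 : ℝ) ^ ((52 : ℝ) * (n * Real.logb 2 n)) := by
  calc (yFreeChordalBipartite.speed n : ℝ) ≤ ((2 ^ (26 * n * Nat.clog 2 (n + 1)) : ℕ) : ℝ) := by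
        exact_mod_cast speed_le_two_pow n
    _ = (2 : ℝ) ^ ((26 * n * Nat.clog 2 (n + 1) : ℕ) : ℝ) := by
        rw [Real.rpow_natCast]
        push_cast
        rfl
    _ ≤ _ := Real.rpow_le_rpow_of_exponent_le (by norm_num) (code_length_le hn)

end Counting

theorem mainTheorem12 :
    yFreeChordalBipartite.IsFactorial ∧
    (∃ c : ℕ, ∀ (V : Type) [Finite V] [Nonempty V] (G : SimpleGraph V),
      yFreeChordalBipartite V G →
        (∃ v : V, (G.neighborSet v).ncard ≤ c) ∨
          ∃ x y : V, x ≠ y ∧ symDiffNumber G x y ≤ c) ∧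
    (∃ K : ℝ, ∀ n : ℕ,
      ∃ enc : {G : SimpleGraph (Fin n) // yFreeChordalBipartite (Fin n) G} → List Bool,
        Function.Injective enc ∧
          ∀ G, ((enc G).length : ℝ) ≤ K * (n * Real.logb 2 n)) := by
  refine ⟨⟨yFreeChordalBipartite_isHereditary, 1 / 6, 52, by norm_num, by norm_num, ?_⟩,
    ⟨24, fun V _ _ G hG => ?_⟩, 52, exists_encoding⟩
  · filter_upwards [Filter.eventually_ge_atTop 9] with n hn
    exact ⟨two_rpow_le_speed hn, speed_le_two_rpow (by omega)⟩
  · rcases exists_degree_le_or_close G hG with h | ⟨x, y, hxy, S, hS, H⟩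
    · exact Or.inl h
    · exact Or.inr ⟨x, y, hxy, (symDiffNumber_le_of_close G x y S H).trans hS⟩
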